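/- Let $p$ be a prime, put $q=p$ if $p>2$ and $q=4$ if $p=2$, and let $\gamma$ be a topological generator of $1+q\mathbb{Z}_p$. Let $\mathbb{C}_p$ be the completion of an algebraic closure of $\mathbb{Q}_p$, let $\mathrm{ord}_p$ be its valuation normalized by $\mathrm{ord}_p(p)=1$ (and $\mathrm{ord}_p(0)=\infty$), and let $\mu_{p^\infty}\subset\mathbb{C}_p$ be the group of roots of unity of $p$-power order; for $\zeta\in\mu_{p^\infty}$ and $N\in\mathbb{Z}_p$ write $\zeta^N$ for $\zeta^m$, where $m$ is any natural number congruent to $N$ modulo the order of $\zeta$. Let $\phi(X,Y)\in\mathbb{Z}_p[[X,Y]]$ and write $\phi(X,Y)=\sum_{j\ge 0}\phi_j(X)Y^j$ with $\phi_j(X)\in\mathbb{Z}_p[[X]]$. Assume that 1. $\phi_\lambda(X)$ is a unit of $\mathbb{Z}_p[[X]]$ for some $\lambda\ge 0$; 2. $\phi$ vanishes at infinitely many points of the form $(\zeta\gamma^{k-2}-1,\ \zeta'\gamma^{\frac{k-2}{2}}-1)$ with $k\ge 2$ an even integer and $\zeta,\zeta'\in\mu_{p^\infty}$. Then there exist $N\in\mathbb{Z}_p$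 and $\xi\in\mu_{p^\infty}$ of multiplicative order at most $\lambda\cdot\frac{p}{p-1}$ such that at least one of the following two statements holds: (a) $\mathrm{ord}_p(\phi(x,y))\ge 1$ for every $\zeta\in\mu_{p^\infty}$ and all $x,y$ in the open unit disc of $\mathbb{C}_p$ with $(x,y)\equiv(\zeta-1,\ \xi^{-1}\zeta^N-1)\pmod p$; (b) $\mathrm{ord}_p(\phi(x,y))\ge 1$ for every $\zeta\in\mu_{p^\infty}$ and all $x,y$ in the open unit disc of $\mathbb{C}_p$ with $(x,y)\equiv(\xi\zeta^N-1,\ \zeta-1)\pmod p$. Here $u\equiv v\pmod p$ means $\mathrm{ord}_p(u-v)\ge 1$, in each coordinate. -/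

import Mathlib

namespace PadicToroidal

/-- The inclusion `ℤ_p → ℂ_p`. -/
noncomputable def toCp (p : ℕ) [Fact p.Prime] : ℤ_[p] →+* ℂ_[p] :=
  (algebraMap ℚ_[p] ℂ_[p]).comp PadicInt.Coe.ringHom

theorem norm_toCp (p : ℕ) [Fact p.Prime] (a : ℤ_[p]) : ‖toCp p a‖ = ‖a‖ := by
  have h := PadicComplex.norm_extends' p (a : ℚ_[p])
  exact h

open Classical in
/-- The `p`-adic order on `ℂ_p`, normalised by `ord_p p = 1`, with `ord_p 0 = ∞`. -/
noncomputable def ordp (p : ℕ) [Fact p.Prime] (z : ℂ_[p]) : EReal :=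
  if z = 0 then ⊤ else ((-Real.logb p ‖z‖ : ℝ) : EReal)

/-- Congruence modulo `p` in `ℂ_p`: the difference lies in `p 𝓞`, `𝓞` the ring of integers. -/
def CongrModP (p : ℕ) [Fact p.Prime] (x a : ℂ_[p]) : Prop :=
  ∃ c : ℂ_[p], ‖c‖ ≤ 1 ∧ x - a = (p : ℂ_[p]) * c

/-- The set `μ_{p^∞}` of roots of unity of `p`-power order in `ℂ_p`. -/
def muPInf (p : ℕ) [Fact p.Prime] : Set ℂ_[p] :=
  {ζ | ∃ n : ℕ, ζ ^ p ^ n = 1}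

/-- `ζ ^ N` for `ζ ∈ μ_{p^∞}` and `N ∈ ℤ_p`: if `ζ` has order `p ^ n`, it is `ζ ^ m` for a natural
number `m ≡ N` modulo `p ^ n` (see `rootPow_eq`). -/
noncomputable def rootPow (p : ℕ) [Fact p.Prime] (ζ : ℂ_[p]) (N : ℤ_[p]) : ℂ_[p] :=
  ζ ^ N.appr (padicValNat p (orderOf ζ))

theorem rootPow_eq (p : ℕ) [hp : Fact p.Prime] (ζ : ℂ_[p]) (N : ℤ_[p]) (n m : ℕ)
    (hζ : ζ ^ p ^ n = 1) (hm : (p : ℤ_[p]) ^ n ∣ N - m) : rootPow p ζ N = ζ ^ m := by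
  obtain ⟨k, hkn, hk⟩ := (Nat.dvd_prime_pow hp.out).1 (orderOf_dvd_of_pow_eq_one hζ)
  have hval : padicValNat p (orderOf ζ) = k := by rw [hk, padicValNat.prime_pow]
  rw [rootPow, hval]
  have h1 : (p : ℤ_[p]) ^ k ∣ N - (N.appr k : ℤ_[p]) :=
    Ideal.mem_span_singleton.1 (PadicInt.appr_spec k N)
  have h2 : (p : ℤ_[p]) ^ k ∣ N - m := (pow_dvd_pow _ hkn).trans hm
  have h3 := PadicInt.zmod_congr_of_sub_mem_span k N (N.appr k) m
    (Ideal.mem_span_singleton.2 h1) (Ideal.mem_span_singleton.2 h2)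
  have h4 : N.appr k ≡ m [MOD p ^ k] := (ZMod.natCast_eq_natCast_iff _ _ _).1 h3
  rw [← hk] at h4
  rw [← pow_mod_orderOf ζ (N.appr k), ← pow_mod_orderOf ζ m, h4]

/-- `q = p` for odd `p`, and `q = 4` for `p = 2`. -/
def qOf (p : ℕ) : ℕ := if p = 2 then 4 else p

/-- `γ` is a topological generator of the multiplicative group `1 + q ℤ_p`. -/
def IsTopGenerator (p : ℕ) [Fact p.Prime] (γ : ℤ_[p]ˣ) : Prop :=
  closure (Subgroup.zpowers γ : Set ℤ_[p]ˣ) = {u : ℤ_[p]ˣ | (qOf p : ℤ_[p]) ∣ (u : ℤ_[p]) - 1}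

/-- The coefficient of `X ^ i Y ^ j` in `φ(X, Y)`; the variable `0` is `X`, the variable `1` is
`Y`. -/
noncomputable def coeffXY {p : ℕ} [Fact p.Prime] (φ : MvPowerSeries (Fin 2) ℤ_[p]) (i j : ℕ) :
    ℤ_[p] :=
  MvPowerSeries.coeff (Finsupp.single 0 i + Finsupp.single 1 j) φ

/-- The series `φ_j(X)` in the expansion `φ(X, Y) = ∑ φ_j(X) Y ^ j`. -/
noncomputable def coeffY {p : ℕ} [Fact p.Prime] (φ : MvPowerSeries (Fin 2) ℤ_[p]) (j : ℕ) :
    PowerSeries ℤ_[p] :=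
  PowerSeries.mk fun i => coeffXY φ i j

/-- The value `φ(x, y)`, for `x`, `y` in the open unit disc of `ℂ_p` (where the series converges,
see `summable_evalXY`). -/
noncomputable def evalXY {p : ℕ} [Fact p.Prime] (φ : MvPowerSeries (Fin 2) ℤ_[p])
    (x y : ℂ_[p]) : ℂ_[p] :=
  ∑' n : ℕ × ℕ, toCp p (coeffXY φ n.1 n.2) * x ^ n.1 * y ^ n.2

theorem summable_evalXY {p : ℕ} [Fact p.Prime] (φ : MvPowerSeries (Fin 2) ℤ_[p])
    (x y : ℂ_[p]) (hx : ‖x‖ < 1) (hy : ‖y‖ < 1) :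
    Summable fun n : ℕ × ℕ => toCp p (coeffXY φ n.1 n.2) * x ^ n.1 * y ^ n.2 := by
  have hg : Summable fun n : ℕ × ℕ => ‖x‖ ^ n.1 * ‖y‖ ^ n.2 :=
    (summable_geometric_of_lt_one (norm_nonneg x) hx).mul_of_nonneg
      (summable_geometric_of_lt_one (norm_nonneg y) hy)
      (fun _ => by positivity) (fun _ => by positivity)
  refine Summable.of_norm_bounded hg fun n => ?_
  rw [norm_mul, norm_mul, norm_pow, norm_pow, norm_toCp, mul_assoc]
  exact mul_le_of_le_one_left (by positivity) (PadicInt.norm_le_one _)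

/-- The points `(ζ γ^(k-2) - 1, ζ' γ^((k-2)/2) - 1)`, for `k ≥ 2` even and `ζ, ζ' ∈ μ_{p^∞}`. -/
def centralPoints (p : ℕ) [Fact p.Prime] (γ : ℤ_[p]ˣ) : Set (ℂ_[p] × ℂ_[p]) :=
  {P | ∃ k : ℕ, 2 ≤ k ∧ Even k ∧ ∃ ζ ∈ muPInf p, ∃ ζ' ∈ muPInf p,
    P = (ζ * toCp p γ ^ (k - 2) - 1, ζ' * toCp p γ ^ ((k - 2) / 2) - 1)}

end PadicToroidal

/-! Since `φ` has integral coefficients it is 1-Lipschitz, and `γ ≡ 1` mod `p`; hence a zero at a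
central point makes `φ` divisible by `p` at the torsion point `(ζ - 1, ζ' - 1)`. If only finitely
many torsion points arose, infinitely many zeros would lie on one arc `a ↦ (ζ a² - 1, ζ' a - 1)`. By
`evalXY_eq_zero_of_infinite`, `φ` would vanish on that arc, in particular at every `a ∈ μ_{p^∞}`,
again giving infinitely many torsion points.

So torsion zeros mod `p` of unbounded order exist. In a cyclic group one coordinate is a power of
the other: up to a swap they are `(ζ - 1, ζ ^ m - 1)`. In one variable, the lowest unit coefficient
controls size down to `1 / p`, so divisibility by `p` spreads from `ζ` to all roots of smaller order
(`norm_evalXY_pow_le`). Compactness of `ℤ_p` gives a limit exponent `N`, and `ξ = 1` works: the unit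
hypothesis serves only to force `λ ≥ 1`. -/

namespace PadicToroidal

/-! ### Integral polynomials over ultrametric fields -/

section Ultrametric

variable {K : Type*} [NormedField K] [IsUltrametricDist K]

theorem norm_pow_sub_pow_le {x y : K} (hx : ‖x‖ ≤ 1) (hy : ‖y‖ ≤ 1) (n : ℕ) :
    ‖x ^ n - y ^ n‖ ≤ ‖x - y‖ := by
  induction n with
  | zero => simp
  | succ n ih =>
    have h : x ^ (n + 1) - y ^ (n + 1) = x ^ n * (x - y) + (x ^ n - y ^ n) * y := by ring
    rw [h]
    refine (IsUltrametricDist.norm_add_le_max _ _).trans (max_le ?_ ?_)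
    · rw [norm_mul, norm_pow]
      exact mul_le_of_le_one_left (norm_nonneg _) (pow_le_one₀ (norm_nonneg _) hx)
    · rw [norm_mul]
      exact (mul_le_of_le_one_right (norm_nonneg _) hy).trans ih

/-- The ring of integers of an ultrametric normed field. -/
def closedUnitBall (K : Type*) [NormedField K] [IsUltrametricDist K] : Subring K where
  carrier := {x | ‖x‖ ≤ 1}
  mul_mem' {a b} ha hb := by
    have ha : ‖a‖ ≤ 1 := ha
    have hb : ‖b‖ ≤ 1 := hb
    simpa using mul_le_one₀ ha (norm_nonneg _) hb
  one_mem' := by simp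
  add_mem' {a b} ha hb := (IsUltrametricDist.norm_add_le_max a b).trans (max_le ha hb)
  zero_mem' := by simp
  neg_mem' {a} ha := by simpa using ha

open Polynomial in
/-- A polynomial with integral coefficients that is small at the points of `s` is bounded at `u`
by the product of the distances from `u` to those points. -/
theorem norm_eval_le_max_prod (s : Finset (closedUnitBall K)) (u : closedUnitBall K) :
    ∃ C : ℝ, 0 ≤ C ∧ ∀ (P : (closedUnitBall K)[X]) (ε : ℝ), 0 ≤ ε →
      (∀ a ∈ s, ‖(↑(P.eval a) : K)‖ ≤ ε) →
      ‖(↑(P.eval u) : K)‖ ≤ max (∏ a ∈ s, ‖(u : K) - a‖) (C * ε) := by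
  classical
  let ι := (closedUnitBall K).subtype
  let v : closedUnitBall K → K := fun a => a
  have hv : Set.InjOn v s := fun a _ b _ h => Subtype.ext h
  refine ⟨∑ a ∈ s, ‖(Lagrange.basis s v a).eval (u : K)‖,
    Finset.sum_nonneg fun _ _ => norm_nonneg _, fun P ε hε hP => ?_⟩
  -- Division by the monic `D` keeps the quotient integral; the remainder is recovered by
  -- interpolation from values of size at most `ε`.
  set D := Lagrange.nodal s (fun a : closedUnitBall K => a)
  have hD : D.Monic := Lagrange.nodal_monic
  have hdiv := P.modByMonic_add_div D
  set R := P %ₘ D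
  have hRdeg : (R.map ι).degree < s.card := by
    refine (degree_map_le).trans_lt ?_
    have := degree_modByMonic_lt P hD
    rwa [Lagrange.degree_nodal] at this
  have hRval : ∀ a ∈ s, (R.map ι).eval (v a) = (↑(P.eval a) : K) := by
    intro a ha
    have h1 : P.eval a = R.eval a := by
      rw [← hdiv]
      simp [D, Lagrange.eval_nodal_at_node (v := fun a : closedUnitBall K => a) ha]
    rw [h1]
    exact eval_map_apply ι a
  have hRint := Lagrange.eq_interpolate_of_eval_eq _ hv hRdeg hRval
  have hRu : ‖(↑(R.eval u) : K)‖ ≤ (∑ a ∈ s, ‖(Lagrange.basis s v a).eval (u : K)‖) * ε := by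
    have h1 : (↑(R.eval u) : K) = (R.map ι).eval (u : K) := (eval_map_apply ι u).symm
    rw [h1, hRint, Lagrange.interpolate_apply, eval_finsetSum, Finset.sum_mul]
    refine (norm_sum_le _ _).trans (Finset.sum_le_sum fun a ha => ?_)
    rw [eval_mul, eval_C, norm_mul, mul_comm]
    exact mul_le_mul_of_nonneg_left (hP a ha) (norm_nonneg _)
  have hu : (↑(P.eval u) : K) = (↑(D.eval u) : K) * (↑((P /ₘ D).eval u) : K) + (↑(R.eval u) : K) := by
    conv_lhs => rw [← hdiv]
    push_cast [eval_add, eval_mul]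
    ring
  rw [hu]
  refine (IsUltrametricDist.norm_add_le_max _ _).trans (max_le_max ?_ hRu)
  rw [norm_mul]
  refine (mul_le_of_le_one_right (norm_nonneg _) ((P /ₘ D).eval u).2).trans ?_
  rw [Lagrange.eval_nodal]
  push_cast
  rw [norm_prod]

end Ultrametric

/-! ### Size of `φ` and of roots of unity in `ℂ_p` -/

variable {p : ℕ} [hp : Fact p.Prime]

theorem norm_natCast_prime : ‖(p : ℂ_[p])‖ = (p : ℝ)⁻¹ := by
  have h := norm_toCp p (p : ℤ_[p])
  rw [map_natCast] at h
  rw [h, PadicInt.norm_p]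

theorem inv_prime_lt_one : (p : ℝ)⁻¹ < 1 :=
  inv_lt_one_of_one_lt₀ (by exact_mod_cast hp.out.one_lt)

theorem norm_toCp_le_one (a : ℤ_[p]) : ‖toCp p a‖ ≤ 1 := by
  rw [norm_toCp]; exact PadicInt.norm_le_one a

theorem one_le_ordp {z : ℂ_[p]} (hz : ‖z‖ ≤ (p : ℝ)⁻¹) : 1 ≤ ordp p z := by
  rw [ordp]
  split_ifs with h
  · exact le_top
  · have hp1 : (1 : ℝ) < p := by exact_mod_cast hp.out.one_lt
    have h1 : Real.logb p ‖z‖ ≤ -1 := by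
      rw [Real.logb_le_iff_le_rpow hp1 (norm_pos_iff.2 h), Real.rpow_neg_one]
      exact hz
    exact_mod_cast (by linarith : (1 : ℝ) ≤ -Real.logb p ‖z‖)

theorem CongrModP.norm_sub_le {x a : ℂ_[p]} (h : CongrModP p x a) : ‖x - a‖ ≤ (p : ℝ)⁻¹ := by
  obtain ⟨c, hc, h⟩ := h
  rw [h, norm_mul, norm_natCast_prime]
  exact mul_le_of_le_one_right (by positivity) hc

/-- Each monomial with integral coefficient is 1-Lipschitz on the polydisc, and the ultrametric
inequality passes this to the sum. -/
theorem norm_evalXY_sub_le (φ : MvPowerSeries (Fin 2) ℤ_[p]) {x y x' y' : ℂ_[p]}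
    (hx : ‖x‖ < 1) (hy : ‖y‖ < 1) (hx' : ‖x'‖ < 1) (hy' : ‖y'‖ < 1) :
    ‖evalXY φ x y - evalXY φ x' y'‖ ≤ max ‖x - x'‖ ‖y - y'‖ := by
  rw [evalXY, evalXY,
    ← (summable_evalXY φ x y hx hy).tsum_sub (summable_evalXY φ x' y' hx' hy')]
  refine IsUltrametricDist.norm_tsum_le_of_forall_le_of_nonneg (by positivity) fun n => ?_
  have h : toCp p (coeffXY φ n.1 n.2) * x ^ n.1 * y ^ n.2
      - toCp p (coeffXY φ n.1 n.2) * x' ^ n.1 * y' ^ n.2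
      = toCp p (coeffXY φ n.1 n.2) *
        ((x ^ n.1 - x' ^ n.1) * y ^ n.2 + x' ^ n.1 * (y ^ n.2 - y' ^ n.2)) := by ring
  rw [h, norm_mul]
  refine (mul_le_of_le_one_left (norm_nonneg _) (norm_toCp_le_one _)).trans ?_
  refine (IsUltrametricDist.norm_add_le_max _ _).trans (max_le_max ?_ ?_)
  · rw [norm_mul, norm_pow y]
    exact (mul_le_of_le_one_right (norm_nonneg _) (pow_le_one₀ (norm_nonneg _) hy.le)).trans
      (norm_pow_sub_pow_le hx.le hx'.le _)
  · rw [norm_mul, norm_pow x']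
    exact (mul_le_of_le_one_left (norm_nonneg _) (pow_le_one₀ (norm_nonneg _) hx'.le)).trans
      (norm_pow_sub_pow_le hy.le hy'.le _)

theorem norm_evalXY_le_of_norm_sub_le (φ : MvPowerSeries (Fin 2) ℤ_[p]) {x y x' y' : ℂ_[p]}
    {r : ℝ} (hx : ‖x‖ < 1) (hy : ‖y‖ < 1) (hx' : ‖x'‖ < 1) (hy' : ‖y'‖ < 1)
    (hxx' : ‖x - x'‖ ≤ r) (hyy' : ‖y - y'‖ ≤ r) (h : ‖evalXY φ x' y'‖ ≤ r) :
    ‖evalXY φ x y‖ ≤ r := by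
  rw [← sub_add_cancel (evalXY φ x y) (evalXY φ x' y')]
  exact (IsUltrametricDist.norm_add_le_max _ _).trans
    (max_le ((norm_evalXY_sub_le φ hx hy hx' hy').trans (max_le hxx' hyy')) h)

theorem norm_eq_one_of_mem_muPInf {ζ : ℂ_[p]} (hζ : ζ ∈ muPInf p) : ‖ζ‖ = 1 := by
  obtain ⟨n, hn⟩ := hζ
  rw [← pow_eq_one_iff_of_nonneg (norm_nonneg ζ) (pow_pos hp.out.pos n).ne', ← norm_pow, hn,
    norm_one]

theorem mul_mem_muPInf {ζ η : ℂ_[p]} (hζ : ζ ∈ muPInf p) (hη : η ∈ muPInf p) :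
    ζ * η ∈ muPInf p := by
  obtain ⟨n, hn⟩ := hζ
  obtain ⟨m, hm⟩ := hη
  refine ⟨n + m, ?_⟩
  rw [mul_pow, pow_add, pow_mul ζ, hn, mul_comm (p ^ n), pow_mul η, hm, one_pow, one_pow, one_mul]

theorem pow_mem_muPInf {ζ : ℂ_[p]} (hζ : ζ ∈ muPInf p) (m : ℕ) : ζ ^ m ∈ muPInf p := by
  obtain ⟨n, hn⟩ := hζ
  exact ⟨n, by rw [← pow_mul, mul_comm, pow_mul, hn, one_pow]⟩

/-- Expanding `((ζ - 1) + 1) ^ p ^ n = 1` modulo `p` shows that `(ζ - 1) ^ p ^ n` is divisible by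
`p`. -/
theorem norm_sub_one_lt_one {ζ : ℂ_[p]} (hζ : ζ ∈ muPInf p) : ‖ζ - 1‖ < 1 := by
  have h1 := norm_eq_one_of_mem_muPInf hζ
  obtain ⟨n, hn⟩ := hζ
  let z : closedUnitBall ℂ_[p] := ⟨ζ, h1.le⟩
  obtain ⟨r, hr⟩ := exists_add_pow_prime_pow_eq hp.out (z - 1) 1 n
  have h2 : (ζ - 1) ^ p ^ n = -((p : ℂ_[p]) * ((ζ - 1) * r)) := by
    have h3 := congrArg (Subtype.val) hr
    push_cast [z] at h3
    rw [sub_add_cancel, hn] at h3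
    linear_combination -h3
  have h4 : ‖ζ - 1‖ ≤ 1 := (z - 1).2
  have h5 : ‖ζ - 1‖ ^ p ^ n < 1 := by
    rw [← norm_pow, h2, norm_neg, norm_mul, norm_mul, norm_natCast_prime]
    refine lt_of_le_of_lt (mul_le_of_le_one_right (by positivity) ?_) inv_prime_lt_one
    exact mul_le_one₀ h4 (norm_nonneg _) r.2
  by_contra h
  exact absurd h5 (not_lt.2 (one_le_pow₀ (not_lt.1 h)))

open Polynomial in
/-- If an integral polynomial is at most `1 / p` at a point of the open unit disc, then it is so on
the whole closed disc through that point. -/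
theorem norm_eval₂_le_inv_prime (P : ℤ_[p][X]) {x x₀ : ℂ_[p]} (hx : ‖x‖ < 1) (hx₀ : ‖x₀‖ ≤ ‖x‖)
    (hP : ‖P.eval₂ (toCp p) x‖ ≤ (p : ℝ)⁻¹) : ‖P.eval₂ (toCp p) x₀‖ ≤ (p : ℝ)⁻¹ := by
  classical
  have hcoeff : ∀ i, ‖P.coeff i‖ ≠ 1 → ‖P.coeff i‖ ≤ (p : ℝ)⁻¹ := by
    intro i hi
    obtain ⟨c, hc⟩ := (PadicInt.norm_lt_one_iff_dvd _).1
      (lt_of_le_of_ne (PadicInt.norm_le_one _) hi)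
    rw [hc, norm_mul, PadicInt.norm_p]
    exact mul_le_of_le_one_right (by positivity) (PadicInt.norm_le_one _)
  by_cases hall : ∀ i, ‖P.coeff i‖ = 1 → ‖x‖ ^ i ≤ (p : ℝ)⁻¹
  · rw [eval₂_eq_sum_range]
    refine IsUltrametricDist.norm_sum_le_of_forall_le_of_nonneg (by positivity) fun i _ => ?_
    rw [norm_mul, norm_pow, norm_toCp]
    by_cases hi : ‖P.coeff i‖ = 1
    · rw [hi, one_mul]
      exact (pow_le_pow_left₀ (norm_nonneg _) hx₀ i).trans (hall i hi)
    · exact (mul_le_of_le_one_right (norm_nonneg _)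
        (pow_le_one₀ (norm_nonneg _) (hx₀.trans hx.le))).trans (hcoeff i hi)
  · exfalso
    push Not at hall
    obtain ⟨i, hi, hi'⟩ := hall
    have hex : ∃ i, ‖P.coeff i‖ = 1 := ⟨i, hi⟩
    -- At the lowest unit coefficient, `|x|^k > 1/p` strictly dominates: earlier terms are at most
    -- `1/p`, later ones at most `|x|^(k+1)`. The value would then exceed `1/p`.
    let k := Nat.find hex
    have hk : ‖P.coeff k‖ = 1 := Nat.find_spec hex
    have hxk : (p : ℝ)⁻¹ < ‖x‖ ^ k :=
      hi'.trans_le (pow_le_pow_of_le_one (norm_nonneg _) hx.le (Nat.find_min' hex hi))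
    have hkmem : k ∈ Finset.range (P.natDegree + 1) := by
      rw [Finset.mem_range, Nat.lt_succ_iff]
      refine le_natDegree_of_ne_zero fun h => ?_
      rw [h, norm_zero] at hk
      exact zero_ne_one hk
    have hxk1 : ‖x‖ ^ (k + 1) < ‖x‖ ^ k := by
      rw [pow_succ]
      exact mul_lt_of_lt_one_right ((by positivity : (0 : ℝ) ≤ (p : ℝ)⁻¹).trans_lt hxk) hx
    rw [eval₂_eq_sum_range, ← Finset.add_sum_erase _ _ hkmem] at hP
    have hrest : ‖∑ j ∈ (Finset.range (P.natDegree + 1)).erase k,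
        toCp p (P.coeff j) * x ^ j‖ ≤ max (p : ℝ)⁻¹ (‖x‖ ^ (k + 1)) := by
      refine IsUltrametricDist.norm_sum_le_of_forall_le_of_nonneg (by positivity) fun j hj => ?_
      rw [norm_mul, norm_pow, norm_toCp]
      rcases lt_or_gt_of_ne (Finset.ne_of_mem_erase hj) with hjk | hjk
      · refine le_max_of_le_left ?_
        exact (mul_le_of_le_one_right (norm_nonneg _) (pow_le_one₀ (norm_nonneg _) hx.le)).trans
          (hcoeff j (Nat.find_min hex hjk))
      · refine le_max_of_le_right ?_
        exact (mul_le_of_le_one_left (by positivity) (PadicInt.norm_le_one _)).trans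
          (pow_le_pow_of_le_one (norm_nonneg _) hx.le hjk)
    have hterm : ‖toCp p (P.coeff k) * x ^ k‖ = ‖x‖ ^ k := by
      rw [norm_mul, norm_pow, norm_toCp, hk, one_mul]
    have h := IsUltrametricDist.norm_add_le_max (toCp p (P.coeff k) * x ^ k +
      ∑ j ∈ (Finset.range (P.natDegree + 1)).erase k, toCp p (P.coeff j) * x ^ j)
      (-∑ j ∈ (Finset.range (P.natDegree + 1)).erase k, toCp p (P.coeff j) * x ^ j)
    rw [add_neg_cancel_right, norm_neg, hterm] at h
    exact absurd h (not_le.2 (max_lt (hP.trans_lt hxk) (hrest.trans_lt (max_lt hxk hxk1))))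

/-! ### Identity principle along arcs -/

open Polynomial Filter Topology in
-- Partial sums are integral polynomials, nearly zero on `s`. The constant in
-- `norm_eval_le_max_prod` does not depend on the polynomial, so the error term disappears in the
-- limit.
theorem norm_evalXY_le_prod (φ : MvPowerSeries (Fin 2) ℤ_[p])
    (A B : (closedUnitBall ℂ_[p])[X]) (s : Finset (closedUnitBall ℂ_[p]))
    (u : closedUnitBall ℂ_[p]) (hAB : ∀ a : closedUnitBall ℂ_[p], a = u ∨ a ∈ s →
      ‖(↑(A.eval a) : ℂ_[p])‖ < 1 ∧ ‖(↑(B.eval a) : ℂ_[p])‖ < 1)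
    (hs : ∀ a ∈ s, evalXY φ ↑(A.eval a) ↑(B.eval a) = 0) :
    ‖evalXY φ ↑(A.eval u) ↑(B.eval u)‖ ≤ ∏ a ∈ s, ‖(u : ℂ_[p]) - a‖ := by
  obtain ⟨M, hM, hbound⟩ := norm_eval_le_max_prod s u
  let P : Finset (ℕ × ℕ) → (closedUnitBall ℂ_[p])[X] := fun t =>
    ∑ n ∈ t, C (⟨toCp p (coeffXY φ n.1 n.2), norm_toCp_le_one _⟩ : closedUnitBall ℂ_[p])
      * A ^ n.1 * B ^ n.2
  have hP : ∀ t a, (↑((P t).eval a) : ℂ_[p]) =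
      ∑ n ∈ t, toCp p (coeffXY φ n.1 n.2) * (↑(A.eval a) : ℂ_[p]) ^ n.1 * (↑(B.eval a) : ℂ_[p]) ^ n.2 := by
    intro t a
    simp only [P, eval_finsetSum, eval_mul, eval_pow, eval_C]
    push_cast
    rfl
  have hlim : ∀ a : closedUnitBall ℂ_[p], a = u ∨ a ∈ s →
      Tendsto (fun t => (↑((P t).eval a) : ℂ_[p])) atTop (𝓝 (evalXY φ ↑(A.eval a) ↑(B.eval a))) := by
    intro a ha
    simp only [hP]
    exact (summable_evalXY φ _ _ (hAB a ha).1 (hAB a ha).2).hasSum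
  have hprod : 0 ≤ ∏ a ∈ s, ‖(u : ℂ_[p]) - a‖ := Finset.prod_nonneg fun _ _ => norm_nonneg _
  refine le_of_forall_pos_le_add fun δ hδ => ?_
  have hε : 0 < δ / (M + 1) := by positivity
  refine le_of_tendsto (hlim u (Or.inl rfl)).norm ?_
  have hev : ∀ᶠ t in atTop, ∀ a ∈ s, ‖(↑((P t).eval a) : ℂ_[p])‖ ≤ δ / (M + 1) := by
    rw [Filter.eventually_all_finset]
    intro a ha
    have h := (hlim a (Or.inr ha)).norm
    rw [hs a ha, norm_zero] at h
    exact (h.eventually_lt_const hε).mono fun _ h => h.le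
  filter_upwards [hev] with t ht
  refine (hbound (P t) _ hε.le ht).trans (max_le (by linarith) ?_)
  have : M * (δ / (M + 1)) ≤ δ := by
    rw [mul_div_assoc', div_le_iff₀ (by positivity)]
    nlinarith
  linarith

theorem norm_mul_sub_one_lt_one {ζ a : ℂ_[p]} (hζ : ζ ∈ muPInf p) (ha : ‖a - 1‖ < 1) :
    ‖ζ * a - 1‖ < 1 := by
  have h : ζ * a - 1 = ζ * (a - 1) + (ζ - 1) := by ring
  rw [h]
  refine (IsUltrametricDist.norm_add_le_max _ _).trans_lt (max_lt ?_ (norm_sub_one_lt_one hζ))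
  rwa [norm_mul, norm_eq_one_of_mem_muPInf hζ, one_mul]

open Polynomial in
/-- An identity principle along a quadratic arc: infinitely many zeros in a closed disc of radius
less than `1` force vanishing on that disc. -/
theorem evalXY_eq_zero_of_infinite (φ : MvPowerSeries (Fin 2) ℤ_[p]) {ζ ζ' : ℂ_[p]}
    (hζ : ζ ∈ muPInf p) (hζ' : ζ' ∈ muPInf p) {r : ℝ} (hr : r < 1)
    (hinf : {a : ℂ_[p] | ‖a - 1‖ ≤ r ∧ evalXY φ (ζ * a ^ 2 - 1) (ζ' * a - 1) = 0}.Infinite)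
    {u : ℂ_[p]} (hu : ‖u - 1‖ ≤ r) : evalXY φ (ζ * u ^ 2 - 1) (ζ' * u - 1) = 0 := by
  classical
  have hball : ∀ a : ℂ_[p], ‖a - 1‖ ≤ r → ‖a‖ ≤ 1 := fun a ha => by
    rw [← sub_add_cancel a 1]
    exact (IsUltrametricDist.norm_add_le_max _ _).trans (max_le (ha.trans hr.le) norm_one.le)
  let A : (closedUnitBall ℂ_[p])[X] :=
    C ⟨ζ, (norm_eq_one_of_mem_muPInf hζ).le⟩ * X ^ 2 - 1
  let B : (closedUnitBall ℂ_[p])[X] := C ⟨ζ', (norm_eq_one_of_mem_muPInf hζ').le⟩ * X - 1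
  have hA : ∀ a : closedUnitBall ℂ_[p], (↑(A.eval a) : ℂ_[p]) = ζ * (a : ℂ_[p]) ^ 2 - 1 := by
    intro a; simp [A]
  have hB : ∀ a : closedUnitBall ℂ_[p], (↑(B.eval a) : ℂ_[p]) = ζ' * (a : ℂ_[p]) - 1 := by
    intro a; simp [B]
  have hAB : ∀ a : closedUnitBall ℂ_[p], ‖(a : ℂ_[p]) - 1‖ ≤ r →
      ‖(↑(A.eval a) : ℂ_[p])‖ < 1 ∧ ‖(↑(B.eval a) : ℂ_[p])‖ < 1 := by
    intro a ha
    rw [hA, hB]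
    refine ⟨norm_mul_sub_one_lt_one hζ ?_, norm_mul_sub_one_lt_one hζ' (ha.trans_lt hr)⟩
    have := norm_pow_sub_pow_le a.2 (norm_one (α := ℂ_[p])).le 2
    rw [one_pow] at this
    exact (this.trans ha).trans_lt hr
  have hr0 : 0 ≤ r := (norm_nonneg _).trans hu
  -- Any `m` of the zeros lie within `r` of `u`, so the product bound is at most `r ^ m`.
  have hle : ∀ m : ℕ, ‖evalXY φ (ζ * u ^ 2 - 1) (ζ' * u - 1)‖ ≤ r ^ m := by
    intro m
    obtain ⟨t, ht, rfl⟩ := hinf.exists_subset_card_eq m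
    let f : ↥t → closedUnitBall ℂ_[p] := fun a => ⟨a.1, hball _ (ht a.2).1⟩
    have hf : Function.Injective f := fun a b h => Subtype.ext (congrArg (fun z => z.1) h)
    have h := norm_evalXY_le_prod φ A B (Finset.univ.image f) ⟨u, hball u hu⟩ ?_ ?_
    · rw [hA, hB] at h
      refine h.trans ?_
      rw [Finset.prod_image hf.injOn]
      refine (Finset.prod_le_prod (fun _ _ => norm_nonneg _) (g := fun _ => r)
        fun a _ => ?_).trans (by simp)
      have h2 : u - a = (u - 1) + -(a.1 - 1) := by ring
      change ‖u - a‖ ≤ r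
      rw [h2]
      exact (IsUltrametricDist.norm_add_le_max _ _).trans
        (max_le hu (by rw [norm_neg]; exact (ht a.2).1))
    · rintro a (rfl | ha)
      · exact hAB _ hu
      · obtain ⟨b, -, rfl⟩ := Finset.mem_image.1 ha
        exact hAB _ (ht b.2).1
    · intro a ha
      obtain ⟨b, -, rfl⟩ := Finset.mem_image.1 ha
      rw [hA, hB]
      exact (ht b.2).2
  exact norm_le_zero_iff.1
    (ge_of_tendsto' (tendsto_pow_atTop_nhds_zero_of_lt_one hr0 hr) hle)

/-! ### From central zeros to torsion zeros modulo `p` -/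

theorem infinite_muPInf : (muPInf p).Infinite := by
  have h : ∀ n : ℕ, ∃ ζ : ℂ_[p], IsPrimitiveRoot ζ (p ^ n) := fun n =>
    HasEnoughRootsOfUnity.exists_primitiveRoot ℂ_[p] (p ^ n)
  choose ζ hζ using h
  refine Set.infinite_of_injective_forall_mem (f := ζ) (fun m n hmn => ?_)
    fun n => ⟨n, (hζ n).pow_eq_one⟩
  have := (hζ m).eq_orderOf.trans ((congrArg orderOf hmn).trans (hζ n).eq_orderOf.symm)
  exact Nat.pow_right_injective hp.out.two_le this

/-- The pairs of `p`-power roots of unity at which `φ(ζ - 1, ζ' - 1)` is divisible by `p`. -/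
def torsionZerosModP (φ : MvPowerSeries (Fin 2) ℤ_[p]) : Set (ℂ_[p] × ℂ_[p]) :=
  {P | P.1 ∈ muPInf p ∧ P.2 ∈ muPInf p ∧ ‖evalXY φ (P.1 - 1) (P.2 - 1)‖ ≤ (p : ℝ)⁻¹}

theorem IsTopGenerator.norm_sub_one_le {γ : ℤ_[p]ˣ} (hγ : IsTopGenerator p γ) :
    ‖toCp p γ - 1‖ ≤ (p : ℝ)⁻¹ := by
  have h : γ ∈ {u : ℤ_[p]ˣ | (qOf p : ℤ_[p]) ∣ (u : ℤ_[p]) - 1} :=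
    hγ ▸ subset_closure (Subgroup.mem_zpowers γ)
  have hpq : (p : ℤ_[p]) ∣ (γ : ℤ_[p]) - 1 := by
    refine dvd_trans ?_ h
    rw [qOf]
    split_ifs with h2
    · subst h2; exact ⟨2, by norm_num⟩
    · exact dvd_rfl
  obtain ⟨c, hc⟩ := hpq
  rw [← map_one (toCp p), ← map_sub, norm_toCp, hc, norm_mul, PadicInt.norm_p]
  exact mul_le_of_le_one_right (by positivity) (PadicInt.norm_le_one c)

theorem norm_toCp_unit_pow_sub_one_le {γ : ℤ_[p]ˣ} (hγ : IsTopGenerator p γ) (m : ℕ) :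
    ‖toCp p γ ^ m - 1‖ ≤ (p : ℝ)⁻¹ := by
  have h := norm_pow_sub_pow_le (norm_toCp_le_one (γ : ℤ_[p])) (norm_one (α := ℂ_[p])).le m
  rw [one_pow] at h
  exact h.trans hγ.norm_sub_one_le

theorem norm_mul_sub_self_le {ζ a : ℂ_[p]} (hζ : ζ ∈ muPInf p) {r : ℝ} (ha : ‖a - 1‖ ≤ r) :
    ‖(ζ - 1) - (ζ * a - 1)‖ ≤ r := by
  have h : (ζ - 1) - (ζ * a - 1) = -(ζ * (a - 1)) := by ring
  rwa [h, norm_neg, norm_mul, norm_eq_one_of_mem_muPInf hζ, one_mul]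

/-- Infinitely many zeros among the central points give infinitely many torsion zeros modulo `p`. -/
theorem infinite_torsionZerosModP {γ : ℤ_[p]ˣ} (hγ : IsTopGenerator p γ)
    (φ : MvPowerSeries (Fin 2) ℤ_[p])
    (hinf : {P ∈ centralPoints p γ | evalXY φ P.1 P.2 = 0}.Infinite) :
    (torsionZerosModP φ).Infinite := by
  intro hfin
  -- Here `a = γ ^ s` with `k - 2 = 2 s`; the halved exponent makes the arc quadratic.
  have hcover : {P ∈ centralPoints p γ | evalXY φ P.1 P.2 = 0} ⊆
      ⋃ Q ∈ torsionZerosModP φ, (fun a : ℂ_[p] => (Q.1 * a ^ 2 - 1, Q.2 * a - 1)) ''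
        {a : ℂ_[p] | ‖a - 1‖ ≤ (p : ℝ)⁻¹ ∧ evalXY φ (Q.1 * a ^ 2 - 1) (Q.2 * a - 1) = 0} := by
    rintro P ⟨⟨k, -, hk, ζ, hζ, ζ', hζ', rfl⟩, hP⟩
    obtain ⟨s, hs⟩ : ∃ s, k - 2 = 2 * s := by
      obtain ⟨c, hc⟩ := hk
      exact ⟨c - 1, by omega⟩
    have hs2 : (k - 2) / 2 = s := by omega
    rw [hs2, hs] at hP ⊢
    have h1 := norm_toCp_unit_pow_sub_one_le hγ (2 * s)
    have h2 := norm_toCp_unit_pow_sub_one_le hγ s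
    simp only [Set.mem_iUnion]
    refine ⟨(ζ, ζ'), ⟨hζ, hζ', ?_⟩, toCp p γ ^ s, ⟨h2, ?_⟩, ?_⟩
    · refine norm_evalXY_le_of_norm_sub_le φ (norm_sub_one_lt_one hζ) (norm_sub_one_lt_one hζ')
        (norm_mul_sub_one_lt_one hζ (h1.trans_lt inv_prime_lt_one))
        (norm_mul_sub_one_lt_one hζ' (h2.trans_lt inv_prime_lt_one))
        (norm_mul_sub_self_le hζ h1) (norm_mul_sub_self_le hζ' h2) ?_
      rw [hP, norm_zero]
      positivity
    · rw [← pow_mul, mul_comm s]; exact hP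
    · simp only [← pow_mul, mul_comm s]
  have hex : ∃ Q ∈ torsionZerosModP φ,
      {a : ℂ_[p] | ‖a - 1‖ ≤ (p : ℝ)⁻¹ ∧
        evalXY φ (Q.1 * a ^ 2 - 1) (Q.2 * a - 1) = 0}.Infinite := by
    by_contra hcon
    refine hinf ((hfin.biUnion fun Q hQ => ?_).subset hcover)
    refine Set.Finite.image _ ?_
    by_contra h
    exact hcon ⟨Q, hQ, h⟩
  obtain ⟨Q, ⟨hQ1, hQ2, -⟩, hQ⟩ := hex
  have hne : Q.2 ≠ 0 := fun h => by
    have := norm_eq_one_of_mem_muPInf hQ2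
    rw [h, norm_zero] at this
    exact zero_ne_one this
  have hmaps : Set.MapsTo (fun η : ℂ_[p] => (Q.1 * η ^ 2, Q.2 * η)) (muPInf p)
      (torsionZerosModP φ) := by
    intro η hη
    refine ⟨mul_mem_muPInf hQ1 (pow_mem_muPInf hη 2), mul_mem_muPInf hQ2 hη, ?_⟩
    -- This radius is large enough for both the known zeros and `η`, yet below `1`.
    have h := evalXY_eq_zero_of_infinite φ hQ1 hQ2 (r := max (p : ℝ)⁻¹ ‖η - 1‖)
      (max_lt inv_prime_lt_one (norm_sub_one_lt_one hη))
      (hQ.mono fun a ha => ⟨ha.1.trans (le_max_left _ _), ha.2⟩) (le_max_right _ _)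
    simp only
    rw [h, norm_zero]
    positivity
  refine Set.infinite_of_injOn_mapsTo (fun a _ b _ h => ?_) hmaps infinite_muPInf hfin
  exact mul_left_cancel₀ hne (congrArg Prod.snd h)

/-! ### Propagation to all orders and the limiting slope -/

open Polynomial Filter Topology in
/-- Smallness of `φ` at one point `(ζ - 1, ζ ^ m - 1)` with `ζ` of order `p ^ n` propagates to all
`p ^ n`-th roots of unity. -/
theorem norm_evalXY_pow_le (φ : MvPowerSeries (Fin 2) ℤ_[p]) {ζ ζ₀ : ℂ_[p]} {n : ℕ} (m : ℕ)
    (hζ : IsPrimitiveRoot ζ (p ^ n)) (hζ₀ : ζ₀ ^ p ^ n = 1)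
    (h : ‖evalXY φ (ζ - 1) (ζ ^ m - 1)‖ ≤ (p : ℝ)⁻¹) :
    ‖evalXY φ (ζ₀ - 1) (ζ₀ ^ m - 1)‖ ≤ (p : ℝ)⁻¹ := by
  let P : Finset (ℕ × ℕ) → ℤ_[p][X] := fun t =>
    ∑ n ∈ t, C (coeffXY φ n.1 n.2) * X ^ n.1 * ((X + 1) ^ m - 1) ^ n.2
  have hP : ∀ t (z : ℂ_[p]), (P t).eval₂ (toCp p) (z - 1) =
      ∑ n ∈ t, toCp p (coeffXY φ n.1 n.2) * (z - 1) ^ n.1 * (z ^ m - 1) ^ n.2 := by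
    intro t z
    simp [P, eval₂_finsetSum, eval₂_mul, eval₂_pow, eval₂_sub, eval₂_add]
  have hμ : ∀ {z : ℂ_[p]}, z ^ p ^ n = 1 → z ∈ muPInf p := fun hz => ⟨n, hz⟩
  have hlim : ∀ {z : ℂ_[p]}, z ^ p ^ n = 1 →
      ∀ᶠ t in atTop, ‖(P t).eval₂ (toCp p) (z - 1) - evalXY φ (z - 1) (z ^ m - 1)‖ < (p : ℝ)⁻¹ := by
    intro z hz
    have hsum := (summable_evalXY φ (z - 1) (z ^ m - 1) (norm_sub_one_lt_one (hμ hz))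
      (norm_sub_one_lt_one (pow_mem_muPInf (hμ hz) m))).hasSum
    have := Metric.tendsto_nhds.1 hsum (p : ℝ)⁻¹ (inv_pos.2 (by exact_mod_cast hp.out.pos))
    filter_upwards [this] with t ht
    rwa [hP, ← dist_eq_norm]
  -- One truncation approximates `φ` to within `1/p` at both points, reducing the claim to a
  -- polynomial.
  obtain ⟨t, ht, ht₀⟩ := ((hlim hζ.pow_eq_one).and (hlim hζ₀)).exists
  have hle : ‖ζ₀ - 1‖ ≤ ‖ζ - 1‖ := by
    have : NeZero (p ^ n) := ⟨(pow_pos hp.out.pos n).ne'⟩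
    obtain ⟨i, -, rfl⟩ := hζ.eq_pow_of_pow_eq_one hζ₀
    have := norm_pow_sub_pow_le (norm_eq_one_of_mem_muPInf (hμ hζ.pow_eq_one)).le
      (norm_one (α := ℂ_[p])).le i
    rwa [one_pow] at this
  have h1 := norm_eval₂_le_inv_prime (P t) (norm_sub_one_lt_one (hμ hζ.pow_eq_one)) hle (by
    rw [← sub_add_cancel ((P t).eval₂ (toCp p) (ζ - 1)) (evalXY φ (ζ - 1) (ζ ^ m - 1))]
    exact (IsUltrametricDist.norm_add_le_max _ _).trans (max_le ht.le h))
  rw [← sub_add_cancel (evalXY φ (ζ₀ - 1) (ζ₀ ^ m - 1)) ((P t).eval₂ (toCp p) (ζ₀ - 1))]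
  refine (IsUltrametricDist.norm_add_le_max _ _).trans (max_le ?_ h1)
  rw [norm_sub_rev]
  exact ht₀.le

open Filter Topology in
/-- If `φ` is small at points `(ζ - 1, ζ ^ m - 1)` with `ζ` of arbitrarily large order, then the
exponents accumulate at some `N ∈ ℤ_p` and `φ` is small along the formal subgroup of slope `N`. -/
theorem exists_forall_norm_evalXY_rootPow_le (φ : MvPowerSeries (Fin 2) ℤ_[p])
    (h : ∀ n : ℕ, ∃ k ≥ n, ∃ ζ : ℂ_[p], IsPrimitiveRoot ζ (p ^ k) ∧
      ∃ m : ℕ, ‖evalXY φ (ζ - 1) (ζ ^ m - 1)‖ ≤ (p : ℝ)⁻¹) :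
    ∃ N : ℤ_[p], ∀ ζ ∈ muPInf p, ‖evalXY φ (ζ - 1) (rootPow p ζ N - 1)‖ ≤ (p : ℝ)⁻¹ := by
  have h' : ∀ n : ℕ, ∃ m : ℕ, ∀ ζ : ℂ_[p], ζ ^ p ^ n = 1 →
      ‖evalXY φ (ζ - 1) (ζ ^ m - 1)‖ ≤ (p : ℝ)⁻¹ := by
    intro n
    obtain ⟨k, hk, ζ, hζ, m, hm⟩ := h n
    refine ⟨m, fun ζ₀ hζ₀ => norm_evalXY_pow_le φ m hζ ?_ hm⟩
    obtain ⟨c, hc⟩ := pow_dvd_pow p hk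
    rw [hc, pow_mul, hζ₀, one_pow]
  choose m hm using h'
  -- For a root killed by `p ^ a`, a late `m (σ k)` is congruent to `N` mod `p ^ a`, and `σ k ≥ a`.
  obtain ⟨N, σ, hσ, hN⟩ := CompactSpace.tendsto_subseq fun n => (m n : ℤ_[p])
  refine ⟨N, fun ζ ⟨a, ha⟩ => ?_⟩
  have hpos : (0 : ℝ) < (p : ℝ) ^ (-(a : ℤ)) := zpow_pos (by exact_mod_cast hp.out.pos) _
  obtain ⟨k, hk, hak⟩ :=
    ((Metric.tendsto_nhds.1 hN _ hpos).and (eventually_ge_atTop a)).exists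
  rw [rootPow_eq p ζ N a (m (σ k)) ha ?_]
  · refine hm _ ζ ?_
    obtain ⟨c, hc⟩ := pow_dvd_pow p (hak.trans (hσ.id_le k))
    rw [hc, pow_mul, ha, one_pow]
  · rw [← Ideal.mem_span_singleton, ← PadicInt.norm_le_pow_iff_mem_span_pow, norm_sub_rev,
      ← dist_eq_norm]
    exact hk.le

/-- The series `φ(Y, X)`. -/
noncomputable def swapXY (φ : MvPowerSeries (Fin 2) ℤ_[p]) : MvPowerSeries (Fin 2) ℤ_[p] :=
  fun d => coeffXY φ (d 1) (d 0)

theorem evalXY_swapXY (φ : MvPowerSeries (Fin 2) ℤ_[p]) (x y : ℂ_[p]) :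
    evalXY (swapXY φ) x y = evalXY φ y x := by
  have hc : ∀ i j, coeffXY (swapXY φ) i j = coeffXY φ j i := by
    intro i j
    change coeffXY φ _ _ = _
    simp
  rw [evalXY, evalXY, ← (Equiv.prodComm ℕ ℕ).tsum_eq]
  refine tsum_congr fun n => ?_
  simp only [Equiv.prodComm_apply, Prod.fst_swap, Prod.snd_swap, hc]
  ring

/-- A series whose `φ_0` is a unit has no zeros in the open unit polydisc. -/
theorem evalXY_ne_zero_of_isUnit_coeffY_zero (φ : MvPowerSeries (Fin 2) ℤ_[p])
    (hunit : IsUnit (coeffY φ 0)) {x y : ℂ_[p]} (hx : ‖x‖ < 1) (hy : ‖y‖ < 1) :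
    evalXY φ x y ≠ 0 := by
  intro h
  have h00 : evalXY φ 0 0 = toCp p (coeffXY φ 0 0) := by
    rw [evalXY, tsum_eq_single (0, 0)]
    · simp
    · rintro ⟨i, j⟩ hij
      rcases Nat.eq_zero_or_pos i with rfl | hi
      · have hj : j ≠ 0 := fun hj => hij (by rw [hj])
        simp [hj]
      · simp [hi.ne']
  have hu : IsUnit (coeffXY φ 0 0) := by
    have := hunit.map (PowerSeries.constantCoeff (R := ℤ_[p]))
    rwa [← PowerSeries.coeff_zero_eq_constantCoeff_apply, coeffY, PowerSeries.coeff_mk] at this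
  have hle := norm_evalXY_sub_le φ hx hy (x' := 0) (y' := 0) (by simp) (by simp)
  rw [h, h00, zero_sub, norm_neg, norm_toCp, PadicInt.isUnit_iff.1 hu, sub_zero, sub_zero] at hle
  exact absurd hle (not_le.2 (max_lt hx hy))

theorem finite_setOf_pow_eq_one (n : ℕ) : {ζ : ℂ_[p] | ζ ^ p ^ n = 1}.Finite := by
  refine (Polynomial.nthRootsFinset (p ^ n) (1 : ℂ_[p])).finite_toSet.subset fun ζ hζ => ?_
  exact (Polynomial.mem_nthRootsFinset (pow_pos hp.out.pos n) _).2 hζ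

/-- Given a pair of `p`-power roots of unity, not both of order dividing `p ^ n`, one of them has
order larger than `p ^ n` and the other one is a power of it. -/
theorem exists_isPrimitiveRoot_and_eq_pow {ζ ζ' : ℂ_[p]} (hζ : ζ ∈ muPInf p)
    (hζ' : ζ' ∈ muPInf p) {n : ℕ} (h : ¬(ζ ^ p ^ n = 1 ∧ ζ' ^ p ^ n = 1)) :
    (∃ k ≥ n, IsPrimitiveRoot ζ (p ^ k) ∧ ∃ m : ℕ, ζ' = ζ ^ m) ∨
      (∃ k ≥ n, IsPrimitiveRoot ζ' (p ^ k) ∧ ∃ m : ℕ, ζ = ζ' ^ m) := by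
  have hord : ∀ {z : ℂ_[p]}, z ∈ muPInf p → ∃ k, IsPrimitiveRoot z (p ^ k) := by
    rintro z ⟨a, ha⟩
    obtain ⟨k, -, hk⟩ := (Nat.dvd_prime_pow hp.out).1 (orderOf_dvd_of_pow_eq_one ha)
    exact ⟨k, hk ▸ IsPrimitiveRoot.orderOf z⟩
  have hpow : ∀ {z : ℂ_[p]} {a b : ℕ}, IsPrimitiveRoot z (p ^ a) → a ≤ b → z ^ p ^ b = 1 :=
    fun hz hab => (hz.pow_eq_one_iff_dvd _).2 (pow_dvd_pow p hab)
  obtain ⟨a, ha⟩ := hord hζ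
  obtain ⟨b, hb⟩ := hord hζ'
  have : ∀ k, NeZero (p ^ k) := fun k => ⟨(pow_pos hp.out.pos k).ne'⟩
  rcases le_total b a with hab | hab
  · left
    refine ⟨a, ?_, ha, ?_⟩
    · by_contra hn
      exact h ⟨hpow ha (by omega), hpow hb (by omega)⟩
    · obtain ⟨m, -, hm⟩ := ha.eq_pow_of_pow_eq_one (hpow hb hab)
      exact ⟨m, hm.symm⟩
  · right
    refine ⟨b, ?_, hb, ?_⟩
    · by_contra hn
      exact h ⟨hpow ha (by omega), hpow hb (by omega)⟩
    · obtain ⟨m, -, hm⟩ := hb.eq_pow_of_pow_eq_one (hpow ha hab)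
      exact ⟨m, hm.symm⟩

/-- This lets the same coordinate play the role of the generator at every level `n`. -/
theorem forall_or_forall_of_antitone {A B : ℕ → Prop} (hA : ∀ m n, m ≤ n → A n → A m)
    (hB : ∀ m n, m ≤ n → B n → B m) (h : ∀ n, A n ∨ B n) : (∀ n, A n) ∨ ∀ n, B n := by
  by_contra hcon
  push Not at hcon
  obtain ⟨⟨a, ha⟩, b, hb⟩ := hcon
  rcases h (max a b) with h | h
  · exact ha (hA _ _ (le_max_left _ _) h)
  · exact hb (hB _ _ (le_max_right _ _) h)

/-- A series with infinitely many torsion zeros modulo `p` is divisible by `p` along a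
one-parameter formal subgroup. -/
theorem exists_slope_of_infinite_torsionZerosModP (φ : MvPowerSeries (Fin 2) ℤ_[p])
    (hinf : (torsionZerosModP φ).Infinite) : ∃ N : ℤ_[p],
      (∀ ζ ∈ muPInf p, ‖evalXY φ (ζ - 1) (rootPow p ζ N - 1)‖ ≤ (p : ℝ)⁻¹) ∨
      (∀ ζ ∈ muPInf p, ‖evalXY φ (rootPow p ζ N - 1) (ζ - 1)‖ ≤ (p : ℝ)⁻¹) := by
  have hfar : ∀ n : ℕ, (∃ k ≥ n, ∃ ζ : ℂ_[p], IsPrimitiveRoot ζ (p ^ k) ∧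
        ∃ m : ℕ, ‖evalXY φ (ζ - 1) (ζ ^ m - 1)‖ ≤ (p : ℝ)⁻¹) ∨
      (∃ k ≥ n, ∃ ζ : ℂ_[p], IsPrimitiveRoot ζ (p ^ k) ∧
        ∃ m : ℕ, ‖evalXY (swapXY φ) (ζ - 1) (ζ ^ m - 1)‖ ≤ (p : ℝ)⁻¹) := by
    intro n
    obtain ⟨⟨ζ, ζ'⟩, ⟨hζ, hζ', hsmall⟩, hn⟩ := hinf.exists_notMem_finite
      ((finite_setOf_pow_eq_one (p := p) n).prod (finite_setOf_pow_eq_one n))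
    rcases exists_isPrimitiveRoot_and_eq_pow hζ hζ' hn with
      ⟨k, hk, hprim, m, hm⟩ | ⟨k, hk, hprim, m, hm⟩
    · exact Or.inl ⟨k, hk, ζ, hprim, m, hm ▸ hsmall⟩
    · refine Or.inr ⟨k, hk, ζ', hprim, m, ?_⟩
      rw [evalXY_swapXY, ← hm]
      exact hsmall
  rcases forall_or_forall_of_antitone
    (fun a b hab ⟨k, hk, hrest⟩ => ⟨k, hab.trans hk, hrest⟩)
    (fun a b hab ⟨k, hk, hrest⟩ => ⟨k, hab.trans hk, hrest⟩) hfar with h | h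
  · obtain ⟨N, hN⟩ := exists_forall_norm_evalXY_rootPow_le φ h
    exact ⟨N, Or.inl hN⟩
  · obtain ⟨N, hN⟩ := exists_forall_norm_evalXY_rootPow_le (swapXY φ) h
    exact ⟨N, Or.inr fun ζ hζ => evalXY_swapXY φ _ _ ▸ hN ζ hζ⟩

end PadicToroidal

/-! ### Conclusion with trivial translation -/

theorem mainTheorem4 (p : ℕ) [Fact p.Prime] (γ : ℤ_[p]ˣ)
    (hγ : PadicToroidal.IsTopGenerator p γ)
    (φ : MvPowerSeries (Fin 2) ℤ_[p]) (lam : ℕ)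
    (hunit : IsUnit (PadicToroidal.coeffY φ lam))
    (hinf : {P ∈ PadicToroidal.centralPoints p γ |
      PadicToroidal.evalXY φ P.1 P.2 = 0}.Infinite) :
    ∃ N : ℤ_[p], ∃ ξ ∈ PadicToroidal.muPInf p,
      (orderOf ξ : ℝ) ≤ (lam : ℝ) * ((p : ℝ) / ((p : ℝ) - 1)) ∧
      ((∀ ζ ∈ PadicToroidal.muPInf p, ∀ x y : ℂ_[p], ‖x‖ < 1 → ‖y‖ < 1 →
          PadicToroidal.CongrModP p x (ζ - 1) →
          PadicToroidal.CongrModP p y (ξ⁻¹ * PadicToroidal.rootPow p ζ N - 1) →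
          1 ≤ PadicToroidal.ordp p (PadicToroidal.evalXY φ x y)) ∨
       (∀ ζ ∈ PadicToroidal.muPInf p, ∀ x y : ℂ_[p], ‖x‖ < 1 → ‖y‖ < 1 →
          PadicToroidal.CongrModP p x (ξ * PadicToroidal.rootPow p ζ N - 1) →
          PadicToroidal.CongrModP p y (ζ - 1) →
          1 ≤ PadicToroidal.ordp p (PadicToroidal.evalXY φ x y))) := by
  have hne : {P ∈ PadicToroidal.centralPoints p γ |
      PadicToroidal.evalXY φ P.1 P.2 = 0}.Nonempty := hinf.nonempty
  have hlam : (1 : ℝ) ≤ lam := by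
    rcases Nat.eq_zero_or_pos lam with rfl | h
    · exfalso
      obtain ⟨_, ⟨k, -, -, ζ, hζ, ζ', hζ', rfl⟩, hP⟩ := hne
      refine PadicToroidal.evalXY_ne_zero_of_isUnit_coeffY_zero φ hunit ?_ ?_ hP
      · exact PadicToroidal.norm_mul_sub_one_lt_one hζ
          ((PadicToroidal.norm_toCp_unit_pow_sub_one_le hγ _).trans_lt
            PadicToroidal.inv_prime_lt_one)
      · exact PadicToroidal.norm_mul_sub_one_lt_one hζ'
          ((PadicToroidal.norm_toCp_unit_pow_sub_one_le hγ _).trans_lt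
            PadicToroidal.inv_prime_lt_one)
    · exact_mod_cast h
  have hp1 : (1 : ℝ) < p := by exact_mod_cast (Fact.out : p.Prime).one_lt
  have hratio : (1 : ℝ) ≤ (p : ℝ) / ((p : ℝ) - 1) := by
    rw [le_div_iff₀ (by linarith)]
    linarith
  obtain ⟨N, hN⟩ := PadicToroidal.exists_slope_of_infinite_torsionZerosModP φ
    (PadicToroidal.infinite_torsionZerosModP hγ φ hinf)
  have hroot : ∀ ζ ∈ PadicToroidal.muPInf p, ‖PadicToroidal.rootPow p ζ N - 1‖ < 1 :=
    fun ζ hζ => PadicToroidal.norm_sub_one_lt_one (PadicToroidal.pow_mem_muPInf hζ _)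
  -- `ξ = 1` has order `1`, within the bound because `λ ≥ 1` and `p / (p - 1) ≥ 1`.
  refine ⟨N, 1, ⟨0, one_pow _⟩, ?_, hN.imp ?_ ?_⟩
  · rw [orderOf_one, Nat.cast_one]
    exact one_le_mul_of_one_le_of_one_le hlam hratio
  · intro h ζ hζ x y hx hy hxζ hyζ
    rw [inv_one, one_mul] at hyζ
    exact PadicToroidal.one_le_ordp (PadicToroidal.norm_evalXY_le_of_norm_sub_le φ hx hy
      (PadicToroidal.norm_sub_one_lt_one hζ) (hroot ζ hζ) hxζ.norm_sub_le hyζ.norm_sub_le (h ζ hζ))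
  · intro h ζ hζ x y hx hy hxζ hyζ
    rw [one_mul] at hxζ
    exact PadicToroidal.one_le_ordp (PadicToroidal.norm_evalXY_le_of_norm_sub_le φ hx hy
      (hroot ζ hζ) (PadicToroidal.norm_sub_one_lt_one hζ) hxζ.norm_sub_le hyζ.norm_sub_le (h ζ hζ))
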